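/- Let $(2,3,7)=\langle x,y,z \mid x^2=y^3=z^7=xyz=1\rangle$ be the hyperbolic triangle group and $(2,2,2,3)=\langle x_1,x_2,x_3,x_4 \mid x_1^2=x_2^2=x_3^2=x_4^3=x_1x_2x_3x_4=1\rangle$ the hyperbolic quadrangle group. A Hurwitz group is a nontrivial finite quotient of $(2,3,7)$; equivalently, a finite group of orientation-preserving diffeomorphisms, of the maximal possible order $84(g-1)$, of a closed orientable surface of some genus $g>1$. A maximal reducible group is a finite quotient of $(2,2,2,3)$ by a torsion-free normal subgroup. Every Hurwitz group that does not surject onto ${\rm PSL}_2(7)$ is a maximal reducible group. In particular, up to isomorphism, ${\rm PSL}_2(7)$ is the only simple Hurwitz group that is not a maximal reducible group: ${\rm PSL}_2(7)$ is a simple Hurwitz group which is not maximal reducible, and every simple Hurwitz group which is not maximal reducible is isomorphic to ${\rm PSL}_2(7)$. -/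

import Mathlib

/-- The relators of the presentation `⟨x, y, z ∣ x² = y³ = z⁷ = xyz = 1⟩`. -/
def triangleRels : Set (FreeGroup (Fin 3)) :=
  {FreeGroup.of 0 ^ 2, FreeGroup.of 1 ^ 3, FreeGroup.of 2 ^ 7,
    FreeGroup.of 0 * FreeGroup.of 1 * FreeGroup.of 2}

/-- The hyperbolic triangle group `(2,3,7)`. -/
abbrev TriangleGroup237 : Type := PresentedGroup triangleRels

/-- The relators of the presentation
`⟨x₁, x₂, x₃, x₄ ∣ x₁² = x₂² = x₃² = x₄³ = x₁x₂x₃x₄ = 1⟩`. -/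
def quadrangleRels : Set (FreeGroup (Fin 4)) :=
  {FreeGroup.of 0 ^ 2, FreeGroup.of 1 ^ 2, FreeGroup.of 2 ^ 2, FreeGroup.of 3 ^ 3,
    FreeGroup.of 0 * FreeGroup.of 1 * FreeGroup.of 2 * FreeGroup.of 3}

/-- The hyperbolic quadrangle group `(2,2,2,3)`. -/
abbrev QuadrangleGroup2223 : Type := PresentedGroup quadrangleRels

/-- A Hurwitz group: a nontrivial finite quotient of the triangle group `(2,3,7)`. -/
def IsHurwitzGroup (H : Type*) [Group H] : Prop :=
  Finite H ∧ Nontrivial H ∧ ∃ φ : TriangleGroup237 →* H, Function.Surjective φ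

/-- A maximal reducible group: a finite quotient of the quadrangle group `(2,2,2,3)` by a
torsion-free normal subgroup, i.e. one whose only element of finite order is `1`. -/
def IsMaximalReducibleGroup (G : Type*) [Group G] : Prop :=
  Finite G ∧ ∃ φ : QuadrangleGroup2223 →* G, Function.Surjective φ ∧
    ∀ k ∈ φ.ker, IsOfFinOrder k → k = 1

/-- The group `PSL₂(7)`: `SL₂` over the field with seven elements modulo its centre. -/
abbrev PSL27 : Type := Matrix.ProjectiveSpecialLinearGroup (Fin 2) (ZMod 7)

/-! Let `Q` be the image of the quadrangle group in the triangle group `T` under `ofQuadrangle`. It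
has index 7, hence is maximal, so for a surjection `f : T → H` either `Q` maps onto `H` or `ker f ≤
Q`. In the first case the composite has torsion-free kernel: the quadrangle group embeds in an
amalgam of two free products of cyclic groups over `ℤ`, so its torsion is conjugate to powers of the
standard generators. These have prime order, and none is killed because `f` kills neither `x` nor
`y`. In the second case `ker f` has normal image in `PSL27`, inside the proper image of `Q`. By
simplicity this image is trivial, so `T → PSL27` factors through `H`. Finally, `PSL27` is no
quotient of the quadrangle group: on the 7 cosets of the image of `Q` it acts by even permutations,
and Ree's inequality would give `12 ≤ 2 + 2 + 2 + 4`. -/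

/-! ### Torsion in amalgamated products -/

namespace Monoid.PushoutI

open Monoid CoprodI Function

variable {ι : Type*} {G : ι → Type*} {H : Type*} [∀ i, Group (G i)] [Group H]
  {φ : ∀ i, H →* G i}

/-- The element of the pushout represented by a list of letters. -/
def listProd (φ : ∀ i, H →* G i) (L : List (Σ i, G i)) : PushoutI φ :=
  (L.map fun l => of l.1 l.2).prod

@[simp] theorem listProd_nil : listProd φ [] = 1 := rfl

@[simp] theorem listProd_cons (l : Σ i, G i) (L : List (Σ i, G i)) :
    listProd φ (l :: L) = of l.1 l.2 * listProd φ L := by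
  simp [listProd]

@[simp] theorem listProd_append (L M : List (Σ i, G i)) :
    listProd φ (L ++ M) = listProd φ L * listProd φ M := by
  simp [listProd]

theorem exists_listProd_eq [Nonempty ι] (g : PushoutI φ) : ∃ L, listProd φ L = g := by
  induction g using PushoutI.induction_on with
  | of i g => exact ⟨[⟨i, g⟩], by simp⟩
  | base h =>
    obtain ⟨i⟩ := ‹Nonempty ι›
    exact ⟨[⟨i, φ i h⟩], by simp [of_apply_eq_base]⟩
  | mul x y hx hy =>
    obtain ⟨L, rfl⟩ := hx
    obtain ⟨M, rfl⟩ := hy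
    exact ⟨L ++ M, by simp⟩

/-- The normal form theorem: a reduced word representing an element of the base is empty. -/
theorem listProd_ne_one (hφ : ∀ i, Injective (φ i)) {L : List (Σ i, G i)} (hL : L ≠ [])
    (hc : L.IsChain fun l l' => l.1 ≠ l'.1) (hr : ∀ l ∈ L, l.2 ∉ (φ l.1).range) :
    listProd φ L ≠ 1 := by
  intro h
  let w : Word G := ⟨L, fun l hl h1 => hr l hl (h1 ▸ one_mem _), hc⟩
  have hw : Reduced φ w := hr
  have hp : ofCoprodI w.prod = listProd φ L := by
    simp [w, Word.prod, listProd, map_list_prod, List.map_map, comp_def]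
  have := hw.eq_empty_of_mem_range hφ (by rw [hp, h]; exact one_mem _)
  exact hL (congrArg Word.toList this)

/-- A cyclically reduced word of length at least two has infinite order. -/
theorem not_isOfFinOrder_listProd (hφ : ∀ i, Injective (φ i)) {c d : Σ i, G i}
    {L : List (Σ i, G i)} (hcd : d.1 ≠ c.1)
    (hc : (c :: (L ++ [d])).IsChain fun l l' => l.1 ≠ l'.1)
    (hr : ∀ l ∈ c :: (L ++ [d]), l.2 ∉ (φ l.1).range) :
    ¬ IsOfFinOrder (listProd φ (c :: (L ++ [d]))) := by
  intro h
  obtain ⟨n, hn, h1⟩ := isOfFinOrder_iff_pow_eq_one.1 h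
  set M := c :: (L ++ [d]) with hM
  -- Powers of the word stay reduced, because its last and first letters lie in different factors.
  have key : ∀ n : ℕ, (List.replicate n M).flatten.IsChain (fun l l' => l.1 ≠ l'.1) := by
    intro n
    induction n with
    | zero => simp
    | succ n ih =>
      rw [List.replicate_succ, List.flatten_cons, List.isChain_append]
      refine ⟨hc, ih, fun x hx y hy => ?_⟩
      have hx' : x = d := by
        have : M.getLast? = some d := by
          rw [hM, ← List.cons_append]; exact List.getLast?_concat
        rw [this] at hx; simpa using hx.symm
      have hy' : y = c := by
        cases n with
        | zero => simp at hy
        | succ n => simp [hM, List.replicate_succ] at hy; exact hy.symm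
      rw [hx', hy']; exact hcd
  have hp : ∀ n : ℕ, listProd φ (List.replicate n M).flatten = listProd φ M ^ n := by
    intro n
    induction n with
    | zero => simp
    | succ n ih => rw [List.replicate_succ, List.flatten_cons, listProd_append, ih, pow_succ']
  refine listProd_ne_one hφ (L := (List.replicate n M).flatten) ?_ (key n) ?_ ((hp n).trans h1)
  · obtain ⟨k, rfl⟩ := Nat.exists_eq_succ_of_ne_zero hn.ne'
    simp [hM, List.replicate_succ]
  · intro l hl
    obtain ⟨m, hm, hl⟩ := List.mem_flatten.1 hl
    rw [List.eq_of_mem_replicate hm] at hl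
    exact hr l hl

theorem not_isOfFinOrder_of_mul_of (hφ : ∀ i, Injective (φ i)) {i j : ι} (hij : i ≠ j)
    {g : G i} {h : G j} (hg : g ∉ (φ i).range) (hh : h ∉ (φ j).range) :
    ¬ IsOfFinOrder (of i g * of j h : PushoutI φ) := by
  have := not_isOfFinOrder_listProd hφ (c := ⟨i, g⟩) (d := ⟨j, h⟩) (L := []) hij.symm
    (by simpa using hij) (by
      intro l hl
      simp only [List.nil_append, List.mem_cons, List.not_mem_nil, or_false] at hl
      rcases hl with rfl | rfl
      exacts [hg, hh])
  simpa using this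

/-- In an amalgamated product, every element of finite order is conjugate into a factor. -/
theorem exists_isConj_of_of_isOfFinOrder [Nonempty ι] (hφ : ∀ i, Injective (φ i))
    {g : PushoutI φ} (hg : IsOfFinOrder g) : ∃ i, ∃ x : G i, IsConj g (of i x) := by
  suffices ∀ (n : ℕ) (L : List (Σ i, G i)), L.length = n → IsOfFinOrder (listProd φ L) →
      ∃ i, ∃ x : G i, IsConj (listProd φ L) (of i x) by
    obtain ⟨L, rfl⟩ := exists_listProd_eq g
    exact this _ L rfl hg
  intro n
  induction n using Nat.strong_induction_on with
  | _ n ih =>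
  intro L hn hL
  -- Rotating a word conjugates its product, so a word may be shortened at any cyclic position.
  have rot : ∀ A B : List (Σ i, G i), IsConj (listProd φ (A ++ B)) (listProd φ (B ++ A)) := by
    intro A B
    refine isConj_iff.2 ⟨(listProd φ A)⁻¹, ?_⟩
    simp
  have step : ∀ A B M : List (Σ i, G i), L = A ++ B → listProd φ (B ++ A) = listProd φ M →
      M.length < n → ∃ i, ∃ x : G i, IsConj (listProd φ L) (of i x) := by
    intro A B M hAB hM hlt
    have hc : IsConj (listProd φ L) (listProd φ M) := by
      rw [hAB, ← hM]; exact rot A B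
    have hfin : IsOfFinOrder (listProd φ M) := by
      obtain ⟨u, hu⟩ := isConj_iff.1 hc
      rw [← hu]
      have := MonoidHom.isOfFinOrder (MulAut.conj u).toMonoidHom hL
      simpa using this
    obtain ⟨i, x, hx⟩ := ih _ hlt M rfl hfin
    exact ⟨i, x, hc.trans hx⟩
  have merge : ∀ (A B : List (Σ i, G i)) (c d : Σ i, G i) (M : List (Σ i, G i)), L = A ++ B →
      B ++ A = c :: d :: M → c.1 = d.1 → ∃ i, ∃ x : G i, IsConj (listProd φ L) (of i x) := by
    rintro A B ⟨i, x⟩ ⟨j, y⟩ M hAB hBA h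
    obtain rfl : i = j := h
    refine step A B (⟨i, x * y⟩ :: M) hAB (by rw [hBA]; simp [mul_assoc]) ?_
    have := congrArg List.length hBA
    have := congrArg List.length hAB
    simp at *; omega
  have absorb : ∀ (A B : List (Σ i, G i)) (c d : Σ i, G i) (M : List (Σ i, G i)), L = A ++ B →
      B ++ A = c :: d :: M → c.2 ∈ (φ c.1).range →
      ∃ i, ∃ x : G i, IsConj (listProd φ L) (of i x) := by
    -- A letter from the amalgamated subgroup can be rewritten in any factor, hence multiplied into
    -- its neighbour.
    rintro A B ⟨i, z⟩ ⟨j, y⟩ M hAB hBA ⟨h, hz⟩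
    obtain rfl : φ i h = z := hz
    refine step A B (⟨j, φ j h * y⟩ :: M) hAB
      (by rw [hBA]; simp [mul_assoc, of_apply_eq_base]) ?_
    have := congrArg List.length hBA
    have := congrArg List.length hAB
    simp at *; omega
  match L, hn with
  | [], _ =>
    obtain ⟨i⟩ := ‹Nonempty ι›
    exact ⟨i, 1, by simp⟩
  | [l], _ => exact ⟨l.1, l.2, by rw [listProd_cons, listProd_nil, mul_one]⟩
  | c :: e :: L', hn =>
    by_contra hcon
    obtain ⟨L₀, d, hd⟩ : ∃ L₀ d, e :: L' = L₀ ++ [d] :=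
      ⟨_, _, (List.dropLast_append_getLast (by simp)).symm⟩
    rw [hd] at hL
    -- A word of length at least two that cannot be shortened is cyclically reduced, hence of
    -- infinite order.
    refine not_isOfFinOrder_listProd hφ (fun h => ?_) ?_ ?_ hL
    · exact hcon (merge (c :: L₀) [d] d c L₀ (by simp [hd]) (by simp) h)
    · rw [← hd, List.isChain_iff_forall_rel_of_append_cons_cons]
      intro a b A B hAB h
      exact hcon (merge A (a :: b :: B) a b (B ++ A) hAB (by simp) h)
    · rw [← hd]
      intro l hl hmem
      obtain ⟨A, B, hAB⟩ := List.append_of_mem hl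
      obtain ⟨d, M, hM⟩ : ∃ d M, B ++ A = d :: M := by
        have := congrArg List.length hAB
        rcases hBA : B ++ A with _ | ⟨d, M⟩
        · simp at hBA; simp [hBA] at this
        · exact ⟨_, _, rfl⟩
      exact hcon (absorb A (l :: B) l d M hAB (by simp [hM]) hmem)

end Monoid.PushoutI

/-! ### Torsion in the quadrangle group -/

namespace QuadrangleGroup2223

open Monoid Function Subgroup

/-- The four standard generators, arranged as two pairs. -/
def gen (i j : Fin 2) : QuadrangleGroup2223 :=
  PresentedGroup.of (![![0, 1], ![2, 3]] i j)

/-- The free product of the cyclic subgroups generated by a pair of standard generators. -/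
abbrev Factor (i : Fin 2) : Type :=
  -- Taking cyclic subgroups of the quadrangle group itself makes the map back an inclusion and
  -- requires no prior knowledge of their orders.
  PushoutI (fun j : Fin 2 => (1 : Unit →* zpowers (gen i j)))

/-- A standard generator as an element of its factor. -/
def factorGen (i j : Fin 2) : Factor i :=
  PushoutI.of (φ := fun j : Fin 2 => (1 : Unit →* zpowers (gen i j))) j
    ⟨gen i j, mem_zpowers _⟩

/-- The element of each factor along which the two factors are amalgamated. -/
def edgeElement (i : Fin 2) : Factor i :=
  -- The signs encode the relation `x₁x₂ = (x₃x₄)⁻¹`.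
  (factorGen i 0 * factorGen i 1) ^ (![1, -1] i : ℤ)

/-- The amalgamated product decomposition of the quadrangle group. -/
abbrev Amalgam : Type :=
  PushoutI (fun i : Fin 2 => zpowersHom (Factor i) (edgeElement i))

theorem of_mul_of_mul_of_mul_of :
    (PresentedGroup.of 0 * PresentedGroup.of 1 * PresentedGroup.of 2 * PresentedGroup.of 3 :
      QuadrangleGroup2223) = 1 :=
  PresentedGroup.one_of_mem (rels := quadrangleRels)
    (x := FreeGroup.of 0 * FreeGroup.of 1 * FreeGroup.of 2 * FreeGroup.of 3)
    (by simp [quadrangleRels])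

theorem of_pow_eq_one (k : Fin 4) :
    (PresentedGroup.of k : QuadrangleGroup2223) ^ (![2, 2, 2, 3] k : ℕ) = 1 :=
  PresentedGroup.one_of_mem (rels := quadrangleRels)
    (x := FreeGroup.of k ^ (![2, 2, 2, 3] k : ℕ))
    (by fin_cases k <;> simp [quadrangleRels])

theorem gen_pow_eq_one (i j : Fin 2) : gen i j ^ (![![2, 2], ![2, 3]] i j : ℕ) = 1 := by
  fin_cases i <;> fin_cases j
  exacts [of_pow_eq_one 0, of_pow_eq_one 1, of_pow_eq_one 2, of_pow_eq_one 3]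

/-- A homomorphism out of the quadrangle group, from the images of the generators. -/
def homOfGens {K : Type*} [Group K] (a b c d : K) (ha : a ^ 2 = 1) (hb : b ^ 2 = 1)
    (hc : c ^ 2 = 1) (hd : d ^ 3 = 1) (h : a * b * c * d = 1) : QuadrangleGroup2223 →* K :=
  PresentedGroup.toGroup (f := ![a, b, c, d]) (by
    intro r hr
    simp only [quadrangleRels, Set.mem_insert_iff, Set.mem_singleton_iff] at hr
    rcases hr with rfl | rfl | rfl | rfl | rfl <;> simpa)

section homOfGens

variable {K : Type*} [Group K] {a b c d : K} (ha : a ^ 2 = 1) (hb : b ^ 2 = 1)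
    (hc : c ^ 2 = 1) (hd : d ^ 3 = 1) (h : a * b * c * d = 1)

theorem homOfGens_of (k : Fin 4) :
    homOfGens a b c d ha hb hc hd h (PresentedGroup.of k) = ![a, b, c, d] k := by
  simp [homOfGens]

end homOfGens

theorem factorGen_pow_eq_one (i j : Fin 2) :
    factorGen i j ^ (![![2, 2], ![2, 3]] i j : ℕ) = 1 := by
  rw [factorGen, ← map_pow]
  exact (congrArg _ (Subtype.ext (gen_pow_eq_one i j))).trans (map_one _)

theorem of_edgeElement (i : Fin 2) :
    (PushoutI.of i (edgeElement i) : Amalgam) = PushoutI.base _ (Multiplicative.ofAdd 1) := by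
  rw [← PushoutI.of_apply_eq_base _ i]
  simp

/-- The comparison homomorphism to the amalgamated product. -/
def toAmalgam : QuadrangleGroup2223 →* Amalgam :=
  homOfGens (PushoutI.of 0 (factorGen 0 0)) (PushoutI.of 0 (factorGen 0 1))
    (PushoutI.of 1 (factorGen 1 0)) (PushoutI.of 1 (factorGen 1 1))
    (by rw [← map_pow, ← map_one (PushoutI.of 0)]; exact congrArg _ (factorGen_pow_eq_one 0 0))
    (by rw [← map_pow, ← map_one (PushoutI.of 0)]; exact congrArg _ (factorGen_pow_eq_one 0 1))
    (by rw [← map_pow, ← map_one (PushoutI.of 1)]; exact congrArg _ (factorGen_pow_eq_one 1 0))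
    (by rw [← map_pow, ← map_one (PushoutI.of 1)]; exact congrArg _ (factorGen_pow_eq_one 1 1))
    (by
      rw [mul_assoc, ← map_mul, ← map_mul, mul_eq_one_iff_eq_inv, ← map_inv]
      have h0 : factorGen 0 0 * factorGen 0 1 = edgeElement 0 := by simp [edgeElement]
      have h1 : (factorGen 1 0 * factorGen 1 1)⁻¹ = edgeElement 1 := by simp [edgeElement]
      rw [h0, h1, of_edgeElement, of_edgeElement])

/-- The homomorphism from a factor of the amalgam to the quadrangle group. -/
def ofFactor (i : Fin 2) : Factor i →* QuadrangleGroup2223 :=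
  PushoutI.lift (fun j => (zpowers (gen i j)).subtype) 1 (fun _ => MonoidHom.comp_one _)

@[simp] theorem ofFactor_factorGen (i j : Fin 2) : ofFactor i (factorGen i j) = gen i j := by
  simp [ofFactor, factorGen]

/-- The homomorphism from the amalgam to the quadrangle group. -/
def ofAmalgam : Amalgam →* QuadrangleGroup2223 :=
  PushoutI.lift ofFactor (zpowersHom _ (gen 0 0 * gen 0 1)) (by
    intro i
    ext
    suffices ofFactor i (edgeElement i) = gen 0 0 * gen 0 1 by simpa
    fin_cases i
    · simp [edgeElement]
    · have := of_mul_of_mul_of_mul_of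
      rw [mul_assoc, mul_eq_one_iff_eq_inv] at this
      simpa [edgeElement, gen] using this.symm)

/-- This one-sided inverse suffices to bring conjugacies found in the amalgam back to the quadrangle
group. -/
theorem ofAmalgam_toAmalgam (q : QuadrangleGroup2223) : ofAmalgam (toAmalgam q) = q := by
  suffices ofAmalgam.comp toAmalgam = MonoidHom.id _ from DFunLike.congr_fun this q
  refine PresentedGroup.ext fun k => ?_
  rw [MonoidHom.comp_apply, toAmalgam, homOfGens_of]
  fin_cases k <;> simp [ofAmalgam] <;> rfl

theorem edgeElement_not_isOfFinOrder (hne : ∀ i j, gen i j ≠ 1) (i : Fin 2) :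
    ¬ IsOfFinOrder (edgeElement i) := by
  have h : ¬ IsOfFinOrder (factorGen i 0 * factorGen i 1) := by
    refine PushoutI.not_isOfFinOrder_of_mul_of (fun j => ?_) (by decide) ?_ ?_
    · exact injective_of_subsingleton _
    all_goals
      rintro ⟨u, hu⟩
      exact hne _ _ (congrArg Subtype.val hu).symm
  fin_cases i
  · simpa [edgeElement] using h
  · simpa [edgeElement, -mul_inv_rev, isOfFinOrder_inv_iff] using h

/-- Every element of finite order of the quadrangle group is conjugate to a power of a standard
generator. -/
theorem exists_isConj_zpow_of_isOfFinOrder (hne : ∀ i j, gen i j ≠ 1) {q : QuadrangleGroup2223}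
    (hq : IsOfFinOrder q) : ∃ i j, ∃ n : ℤ, IsConj q (gen i j ^ n) := by
  have hinj (i : Fin 2) : Injective (zpowersHom (Factor i) (edgeElement i)) := by
    intro m n hmn
    exact injective_zpow_iff_not_isOfFinOrder.2 (edgeElement_not_isOfFinOrder hne i) hmn
  obtain ⟨i, y, hy⟩ := PushoutI.exists_isConj_of_of_isOfFinOrder hinj
    (MonoidHom.isOfFinOrder toAmalgam hq)
  have hyfin : IsOfFinOrder y := by
    obtain ⟨u, hu⟩ := isConj_iff.1 hy
    rw [← (PushoutI.of_injective hinj i).isOfFinOrder_iff, ← hu]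
    exact MonoidHom.isOfFinOrder (MulAut.conj u).toMonoidHom
      (MonoidHom.isOfFinOrder toAmalgam hq)
  obtain ⟨j, z, hz⟩ := PushoutI.exists_isConj_of_of_isOfFinOrder
    (fun _ => injective_of_subsingleton _) hyfin
  obtain ⟨n, hn⟩ := mem_zpowers_iff.1 z.2
  refine ⟨i, j, n, ?_⟩
  have h1 := ofAmalgam.map_isConj hy
  have h2 := (ofFactor i).map_isConj hz
  rw [ofAmalgam_toAmalgam, ofAmalgam, PushoutI.lift_of] at h1
  rw [ofFactor, PushoutI.lift_of] at h2
  rw [hn]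
  exact h1.trans h2

/-- A homomorphism from the quadrangle group that kills no standard generator has torsion-free
kernel. -/
theorem eq_one_of_mem_ker_of_isOfFinOrder {K : Type*} [Group K] (f : QuadrangleGroup2223 →* K)
    (hf : ∀ k, f (PresentedGroup.of k) ≠ 1) {q : QuadrangleGroup2223} (hq : q ∈ f.ker)
    (hfin : IsOfFinOrder q) : q = 1 := by
  have hf' (i j : Fin 2) : f (gen i j) ≠ 1 := hf _
  obtain ⟨i, j, n, h⟩ := exists_isConj_zpow_of_isOfFinOrder
    (fun i j h => hf' i j (by rw [h, map_one])) hfin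
  have h1 : f (gen i j) ^ n = 1 := by
    have := f.map_isConj h
    rwa [MonoidHom.mem_ker.1 hq, isConj_one_right, map_zpow] at this
  have hp : (![![2, 2], ![2, 3]] i j : ℕ).Prime := by
    fin_cases i <;> fin_cases j <;> norm_num
  have := Fact.mk hp
  have ho : orderOf (f (gen i j)) = (![![2, 2], ![2, 3]] i j : ℕ) :=
    orderOf_eq_prime (by rw [← map_pow, gen_pow_eq_one, map_one]) (hf' i j)
  rw [← orderOf_dvd_iff_zpow_eq_one, ho] at h1
  obtain ⟨m, rfl⟩ := h1
  rw [zpow_mul, zpow_natCast, gen_pow_eq_one, one_zpow, isConj_comm, isConj_one_right] at h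
  exact h

end QuadrangleGroup2223

/-! ### Reflection length and Ree's inequality -/

namespace Equiv.Perm

open Module

variable {α : Type*}

/-- The operator `f ↦ f ∘ σ - f` on rational functions on a permuted set. -/
noncomputable def coboundary (σ : Perm α) : (α → ℚ) →ₗ[ℚ] (α → ℚ) :=
  LinearMap.funLeft ℚ ℚ σ - LinearMap.id

@[simp] theorem coboundary_apply (σ : Perm α) (f : α → ℚ) (p : α) :
    coboundary σ f p = f (σ p) - f p := rfl

/-- The rank of `f ↦ f ∘ σ - f`. -/
noncomputable def reflectionLength (σ : Perm α) : ℕ :=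
  finrank ℚ (LinearMap.range (coboundary σ))

theorem reflectionLength_one : reflectionLength (1 : Perm α) = 0 := by
  have : coboundary (1 : Perm α) = 0 := by ext; simp
  rw [reflectionLength, this, LinearMap.range_zero, finrank_bot]

/-- Cocycle identity: `f ∘ στ - f = (f ∘ σ - f) ∘ τ + (f ∘ τ - f)`. -/
theorem reflectionLength_mul_le [Fintype α] (σ τ : Perm α) :
    reflectionLength (σ * τ) ≤ reflectionLength σ + reflectionLength τ := by
  have h : LinearMap.range (coboundary (σ * τ)) ≤
      (LinearMap.range (coboundary σ)).map (LinearMap.funLeft ℚ ℚ τ) ⊔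
        LinearMap.range (coboundary τ) := by
    rintro _ ⟨f, rfl⟩
    refine Submodule.mem_sup.2 ⟨LinearMap.funLeft ℚ ℚ τ (coboundary σ f),
      ⟨_, ⟨f, rfl⟩, rfl⟩, coboundary τ f, ⟨f, rfl⟩, ?_⟩
    ext p
    simp [LinearMap.funLeft_apply]
  refine (Submodule.finrank_mono h).trans
    ((Submodule.finrank_add_le_finrank_add_finrank _ _).trans ?_)
  exact Nat.add_le_add_right (Submodule.finrank_map_le _ _) _

theorem reflectionLength_swap_le [DecidableEq α] (x y : α) : reflectionLength (swap x y) ≤ 1 := by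
  have h : LinearMap.range (coboundary (swap x y)) ≤
      Submodule.span ℚ {(Pi.single x 1 - Pi.single y 1 : α → ℚ)} := by
    rintro _ ⟨f, rfl⟩
    refine Submodule.mem_span_singleton.2 ⟨f y - f x, ?_⟩
    ext p
    by_cases hx : p = x
    · subst hx
      by_cases hy : p = y
      · subst hy; simp
      · simp [hy]
    · by_cases hy : p = y
      · subst hy; simp [hx]
      · simp [hx, hy, swap_apply_of_ne_of_ne]
  exact (Submodule.finrank_mono h).trans
    ((finrank_span_le_card _).trans (by simp))

variable [Fintype α] [DecidableEq α]

theorem reflectionLength_formPerm_le (l : List α) :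
    reflectionLength l.formPerm ≤ l.length - 1 := by
  induction l with
  | nil => simp [reflectionLength_one]
  | cons x l ih =>
    cases l with
    | nil => simp [reflectionLength_one]
    | cons y l =>
      rw [List.formPerm_cons_cons]
      refine (reflectionLength_mul_le _ _).trans ?_
      have := reflectionLength_swap_le x y
      simp at ih ⊢
      omega

/-- A `k`-cycle is a product of `k - 1` transpositions, each of length at most one; disjoint cycles
add up. -/
theorem reflectionLength_add_card_cycleType_le (σ : Perm α) :
    reflectionLength σ + σ.cycleType.card ≤ σ.cycleType.sum := by
  induction σ using cycle_induction_on with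
  | base_one => simp [reflectionLength_one]
  | base_cycles σ hσ =>
    obtain ⟨x, hx, -⟩ := id hσ
    have h := reflectionLength_formPerm_le (σ.toList x)
    rw [formPerm_toList, hσ.cycleOf_eq hx, length_toList, hσ.cycleOf_eq hx] at h
    have := hσ.two_le_card_support
    rw [hσ.cycleType]
    simp
    omega
  | induction_disjoint σ τ hd _ hσ hτ =>
    rw [hd.cycleType_mul, Multiset.card_add, Multiset.sum_add]
    have := reflectionLength_mul_le σ τ
    omega

theorem cycleType_eq_replicate {p : ℕ} (hp : p.Prime) {σ : Perm α} (h : σ ^ p = 1) :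
    σ.cycleType = Multiset.replicate σ.cycleType.card p := by
  refine Multiset.eq_replicate.2 ⟨rfl, fun n hn => ?_⟩
  have h1 : n ∣ p := (dvd_of_mem_cycleType hn).trans (orderOf_dvd_of_pow_eq_one h)
  exact ((Nat.dvd_prime hp).1 h1).resolve_left (by have := two_le_of_mem_cycleType hn; omega)

theorem reflectionLength_le_of_pow_eq_one {p : ℕ} (hp : p.Prime) {σ : Perm α} (h : σ ^ p = 1) :
    ∃ k, σ.cycleType = Multiset.replicate k p ∧ k * p ≤ Fintype.card α ∧
      reflectionLength σ + k ≤ k * p := by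
  refine ⟨_, cycleType_eq_replicate hp h, ?_, ?_⟩
  · have := σ.sum_cycleType
    rw [cycleType_eq_replicate hp h, Multiset.sum_replicate, smul_eq_mul] at this
    exact this.trans_le (Finset.card_le_univ _)
  · have := reflectionLength_add_card_cycleType_le σ
    rw [cycleType_eq_replicate hp h, Multiset.sum_replicate, smul_eq_mul] at this
    simpa using this

/-- **Ree's inequality** for four permutations, by Scott's argument. -/
theorem two_mul_card_sub_one_le_of_transitive {a b c d : Perm α} (h : a * b * c * d = 1)
    (ht : ∀ p q, ∃ g ∈ Subgroup.closure {a, b, c, d}, g p = q) :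
    2 * (Fintype.card α - 1) ≤ reflectionLength a + reflectionLength b + reflectionLength c +
      reflectionLength d := by
  rcases isEmpty_or_nonempty α with hα | ⟨⟨p₀⟩⟩
  · simp
  have inv_of (F : α → ℚ) (ha : ∀ p, F (a p) = F p) (hb : ∀ p, F (b p) = F p)
      (hc : ∀ p, F (c p) = F p) (hd : ∀ p, F (d p) = F p) : ∀ p, F p = F p₀ := by
    intro p
    obtain ⟨g, hg, rfl⟩ := ht p₀ p
    suffices ∀ q, F (g q) = F q from this _
    induction hg using Subgroup.closure_induction with
    | mem g hg => rcases hg with rfl | rfl | rfl | rfl <;> assumption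
    | one => simp
    | mul g g' _ _ h h' => intro q; rw [mul_apply, h, h']
    | inv g _ h => intro q; rw [← h (g⁻¹ q)]; simp
  let L : (α → ℚ) →ₗ[ℚ] LinearMap.range (coboundary a) × LinearMap.range (coboundary b) ×
      LinearMap.range (coboundary c) × LinearMap.range (coboundary d) :=
    (coboundary a).rangeRestrict.prod ((coboundary b).rangeRestrict.prod
      ((coboundary c).rangeRestrict.prod (coboundary d).rangeRestrict))
  let P (σ : Perm α) : (α → ℚ) →ₗ[ℚ] (α → ℚ) := LinearMap.funLeft ℚ ℚ σ
  let M : (LinearMap.range (coboundary a) × LinearMap.range (coboundary b) ×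
      LinearMap.range (coboundary c) × LinearMap.range (coboundary d)) →ₗ[ℚ] (α → ℚ) :=
    (P (b * c * d) ∘ₗ Submodule.subtype _).coprod ((P (c * d) ∘ₗ Submodule.subtype _).coprod
      ((P d ∘ₗ Submodule.subtype _).coprod (Submodule.subtype _)))
  -- The sum telescopes to `f ∘ (abcd) - f = 0`.
  have hML : LinearMap.range L ≤ LinearMap.ker M := by
    rintro _ ⟨f, rfl⟩
    ext p
    have hp : a (b (c (d p))) = p := by
      have := congrArg (fun σ : Perm α => σ p) h
      simpa using this
    simp [L, M, P, LinearMap.funLeft_apply, hp]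
  have hL : finrank ℚ (LinearMap.ker L) ≤ 1 := by
    have : LinearMap.ker L ≤ Submodule.span ℚ {(fun _ => 1 : α → ℚ)} := by
      intro f hf
      refine Submodule.mem_span_singleton.2 ⟨f p₀, ?_⟩
      have hf' : coboundary a f = 0 ∧ coboundary b f = 0 ∧ coboundary c f = 0 ∧
          coboundary d f = 0 := by
        simpa [L, LinearMap.mem_ker, Prod.ext_iff, Subtype.ext_iff] using hf
      obtain ⟨ha, hb, hc, hd⟩ := hf'
      ext p
      have := inv_of f (fun p => sub_eq_zero.1 (congrFun ha p))
        (fun p => sub_eq_zero.1 (congrFun hb p)) (fun p => sub_eq_zero.1 (congrFun hc p))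
        (fun p => sub_eq_zero.1 (congrFun hd p)) p
      simp [this]
    exact (Submodule.finrank_mono this).trans ((finrank_span_le_card _).trans (by simp))
  -- A functional vanishing on the range of `M` is invariant under `d`, then `c`, `b`, `a`, each
  -- step removing the translation in the next summand; by transitivity it is a multiple of the
  -- coordinate sum.
  have hM : finrank ℚ (LinearMap.range M).dualAnnihilator ≤ 1 := by
    have : (LinearMap.range M).dualAnnihilator ≤
        Submodule.span ℚ {(∑ p, LinearMap.proj p : (α → ℚ) →ₗ[ℚ] ℚ)} := by
      intro l hl
      rw [Submodule.mem_dualAnnihilator] at hl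
      have hd : ∀ f, l (P d f) = l f := fun f => by
        have := hl _ ⟨(0, 0, 0, ⟨coboundary d f, f, rfl⟩), rfl⟩
        have h2 : l (coboundary d f) = 0 := by simpa [M] using this
        simpa [coboundary, sub_eq_zero] using h2
      have hc : ∀ f, l (P c f) = l f := fun f => by
        have := hl _ ⟨(0, 0, ⟨coboundary c f, f, rfl⟩, 0), rfl⟩
        have h2 : l (P d (coboundary c f)) = 0 := by simpa [M] using this
        rw [hd] at h2
        simpa [coboundary, sub_eq_zero] using h2
      have hcd : ∀ f, l (P (c * d) f) = l f := fun f => by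
        rw [← hc f, ← hd (P c f)]; rfl
      have hb : ∀ f, l (P b f) = l f := fun f => by
        have := hl _ ⟨(0, ⟨coboundary b f, f, rfl⟩, 0, 0), rfl⟩
        have h2 : l (P (c * d) (coboundary b f)) = 0 := by simpa [M] using this
        rw [hcd] at h2
        simpa [coboundary, sub_eq_zero] using h2
      have hbcd : ∀ f, l (P (b * c * d) f) = l f := fun f => by
        rw [← hb f, ← hcd (P b f)]; rfl
      have ha : ∀ f, l (P a f) = l f := fun f => by
        have := hl _ ⟨(⟨coboundary a f, f, rfl⟩, 0, 0, 0), rfl⟩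
        have h2 : l (P (b * c * d) (coboundary a f)) = 0 := by simpa [M] using this
        rw [hbcd] at h2
        simpa [coboundary, sub_eq_zero] using h2
      have hsingle (σ : Perm α) (hσ : ∀ f, l (P σ f) = l f) (p : α) :
          l (Pi.single (σ p) 1) = l (Pi.single p 1) := by
        rw [← hσ]
        congr 1
        ext q
        simp [P, LinearMap.funLeft_apply, Pi.single_apply]
      have := inv_of (fun p => l (Pi.single p 1)) (hsingle a ha) (hsingle b hb) (hsingle c hc)
        (hsingle d hd)
      refine Submodule.mem_span_singleton.2 ⟨l (Pi.single p₀ 1), ?_⟩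
      refine LinearMap.pi_ext' fun p => ?_
      ext
      simp [this p, Pi.single_apply]
    exact (Submodule.finrank_mono this).trans ((finrank_span_le_card _).trans (by simp))
  -- With `n` points, `n - 1 ≤ rank L ≤ dim ker M`, and `dim ker M` is the sum of the lengths minus
  -- `rank M ≥ n - 1`.
  have h1 := LinearMap.finrank_range_add_finrank_ker L
  have h2 := LinearMap.finrank_range_add_finrank_ker M
  have h3 := Subspace.finrank_add_finrank_dualAnnihilator_eq (LinearMap.range M)
  have h4 := Submodule.finrank_mono hML
  rw [Module.finrank_pi] at h1 h3
  simp only [Module.finrank_prod] at h2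
  simp only [reflectionLength]
  omega

/-- Seven points carry no transitive action generated by three even involutions whose product has
order three. -/
theorem not_transitive_of_card_eq_seven (hα : Fintype.card α = 7) {a b c d : Perm α}
    (ha : a ^ 2 = 1) (hb : b ^ 2 = 1) (hc : c ^ 2 = 1) (hd : d ^ 3 = 1)
    (sa : sign a = 1) (sb : sign b = 1) (sc : sign c = 1) (h : a * b * c * d = 1) :
    ¬ ∀ p q, ∃ g ∈ Subgroup.closure {a, b, c, d}, g p = q := by
  intro ht
  have key := two_mul_card_sub_one_le_of_transitive h ht
  have h2 (σ : Perm α) (hσ : σ ^ 2 = 1) (hs : sign σ = 1) : reflectionLength σ ≤ 2 := by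
    obtain ⟨k, hk, h1, h2⟩ := reflectionLength_le_of_pow_eq_one Nat.prime_two hσ
    rw [sign_of_cycleType, hk, Multiset.sum_replicate, Multiset.card_replicate] at hs
    -- Three transpositions would be odd, so at most two occur.
    have : k ≠ 3 := by rintro rfl; exact absurd hs (by decide)
    omega
  have h3 : reflectionLength d ≤ 4 := by
    obtain ⟨k, hk, h1, h2⟩ := reflectionLength_le_of_pow_eq_one Nat.prime_three hd
    omega
  have := h2 a ha sa
  have := h2 b hb sb
  have := h2 c hc sc
  omega

end Equiv.Perm

/-! ### The triangle group and its subgroup of index seven -/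

namespace TriangleGroup237

open Subgroup
open scoped Pointwise

/-- The generator of order two. -/
def x : TriangleGroup237 := PresentedGroup.of 0

/-- The generator of order three. -/
def y : TriangleGroup237 := PresentedGroup.of 1

theorem x_sq : x ^ 2 = 1 :=
  PresentedGroup.one_of_mem (rels := triangleRels) (x := FreeGroup.of 0 ^ 2)
    (by simp [triangleRels])

theorem y_cube : y ^ 3 = 1 :=
  PresentedGroup.one_of_mem (rels := triangleRels) (x := FreeGroup.of 1 ^ 3)
    (by simp [triangleRels])

theorem of_two_pow : (PresentedGroup.of 2 : TriangleGroup237) ^ 7 = 1 :=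
  PresentedGroup.one_of_mem (rels := triangleRels) (x := FreeGroup.of 2 ^ 7)
    (by simp [triangleRels])

theorem of_two : (PresentedGroup.of 2 : TriangleGroup237) = (x * y)⁻¹ := by
  rw [eq_inv_iff_mul_eq_one, mul_eq_one_iff_eq_inv, eq_comm, inv_eq_iff_mul_eq_one]
  exact PresentedGroup.one_of_mem (rels := triangleRels)
    (x := FreeGroup.of 0 * FreeGroup.of 1 * FreeGroup.of 2) (by simp [triangleRels])

theorem x_mul_y_pow : (x * y) ^ 7 = 1 := by
  simpa [of_two, -mul_inv_rev] using of_two_pow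

theorem x_inv : x⁻¹ = x := by
  rw [inv_eq_iff_mul_eq_one, ← sq, x_sq]

theorem y_inv_sq : y⁻¹ * y⁻¹ = y := by
  rw [← mul_inv_rev, inv_eq_iff_mul_eq_one, ← pow_two, ← pow_succ, y_cube]

theorem eq_top_of_mem {S : Subgroup TriangleGroup237} (hx : x ∈ S) (hy : y ∈ S) : S = ⊤ := by
  rw [eq_top_iff, ← PresentedGroup.closure_range_of, closure_le]
  rintro _ ⟨k, rfl⟩
  fin_cases k
  · exact hx
  · exact hy
  · exact of_two ▸ inv_mem (mul_mem hx hy)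

/-- A homomorphism out of the triangle group, from the images of `x` and `y`. -/
def homOfGens {K : Type*} [Group K] (a b : K) (ha : a ^ 2 = 1) (hb : b ^ 3 = 1)
    (hab : (a * b) ^ 7 = 1) : TriangleGroup237 →* K :=
  PresentedGroup.toGroup (f := ![a, b, (a * b)⁻¹]) (by
    intro r hr
    simp only [triangleRels, Set.mem_insert_iff, Set.mem_singleton_iff] at hr
    rcases hr with rfl | rfl | rfl | rfl
    · simpa
    · simpa
    · simpa [-mul_inv_rev]
    · simp)

section homOfGens

variable {K : Type*} [Group K] {a b : K} (ha : a ^ 2 = 1) (hb : b ^ 3 = 1)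
    (hab : (a * b) ^ 7 = 1)

@[simp] theorem homOfGens_x : homOfGens a b ha hb hab x = a := by
  simp [homOfGens, x]

@[simp] theorem homOfGens_y : homOfGens a b ha hb hab y = b := by
  simp [homOfGens, y]

end homOfGens

/-- Since 2, 3, 7 are pairwise coprime, killing one of `x`, `y` kills the other. -/
theorem map_x_ne_one_and_map_y_ne_one {K : Type*} [Group K] [Nontrivial K] {f : TriangleGroup237 →* K}
    (hf : Function.Surjective f) : f x ≠ 1 ∧ f y ≠ 1 := by
  have hker (h : x ∈ f.ker) (h' : y ∈ f.ker) : False := by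
    have := eq_top_of_mem h h'
    obtain ⟨k, hk⟩ := exists_ne (1 : K)
    obtain ⟨t, rfl⟩ := hf k
    exact hk (MonoidHom.mem_ker.1 (this ▸ mem_top t))
  have h7 : (f x * f y) ^ 7 = 1 := by rw [← map_mul, ← map_pow, x_mul_y_pow, map_one]
  have h2 : f x ^ 2 = 1 := by rw [← map_pow, x_sq, map_one]
  have h3 : f y ^ 3 = 1 := by rw [← map_pow, y_cube, map_one]
  constructor
  · intro hx
    refine hker hx ?_
    rw [hx, one_mul] at h7
    calc f y = f y ^ 7 * ((f y ^ 3) ^ 2)⁻¹ := by group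
      _ = 1 := by rw [h7, h3]; simp
  · intro hy
    refine hker ?_ hy
    rw [hy, mul_one] at h7
    calc f x = f x ^ 7 * ((f x ^ 2) ^ 3)⁻¹ := by group
      _ = 1 := by rw [h7, h2]; simp

theorem conj_x_sq (g : TriangleGroup237) : (g⁻¹ * x * g) ^ 2 = 1 := by
  calc (g⁻¹ * x * g) ^ 2 = g⁻¹ * (x * x) * g := by simp only [sq]; group
    _ = 1 := by rw [← sq, x_sq]; simp

/-- The homomorphism from the quadrangle group `(2,2,2,3)` to the triangle group `(2,3,7)` with
image of index seven. -/
def ofQuadrangle : QuadrangleGroup2223 →* TriangleGroup237 :=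
  QuadrangleGroup2223.homOfGens
    -- In `perm`, `x` fixes 3, 5, 6 and `y` fixes 0. The conjugators carry 0 to 3, 6, 5 in turn, so
    -- all four images stabilise 0.
    ((y⁻¹ * x)⁻¹ * x * (y⁻¹ * x))
    ((y⁻¹ * x * y * x)⁻¹ * x * (y⁻¹ * x * y * x))
    ((y * x * y * x)⁻¹ * x * (y * x * y * x))
    y
    (conj_x_sq _) (conj_x_sq _) (conj_x_sq _)
    y_cube
    (calc
      _ = x⁻¹ * y * x * (y⁻¹ * y⁻¹) * x⁻¹ * y * x * (y⁻¹ * y⁻¹) * x * y * x * y * x * y := by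
        group
      _ = (x * y) ^ 7 := by
        rw [x_inv, y_inv_sq]; simp [pow_succ, mul_assoc]
      _ = 1 := x_mul_y_pow)

theorem ofQuadrangle_of (k : Fin 4) : ofQuadrangle (PresentedGroup.of k) =
    ![(y⁻¹ * x)⁻¹ * x * (y⁻¹ * x),
      (y⁻¹ * x * y * x)⁻¹ * x * (y⁻¹ * x * y * x),
      (y * x * y * x)⁻¹ * x * (y * x * y * x),
      y] k :=
  QuadrangleGroup2223.homOfGens_of _ _ _ _ _ k

theorem ofQuadrangle_range_le_iff {S : Subgroup TriangleGroup237} :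
    ofQuadrangle.range ≤ S ↔ (y⁻¹ * x)⁻¹ * x * (y⁻¹ * x) ∈ S ∧
      (y⁻¹ * x * y * x)⁻¹ * x * (y⁻¹ * x * y * x) ∈ S ∧
      (y * x * y * x)⁻¹ * x * (y * x * y * x) ∈ S ∧ y ∈ S := by
  rw [MonoidHom.range_eq_map, ← PresentedGroup.closure_range_of, MonoidHom.map_closure, closure_le,
    ← Set.range_comp, Set.range_subset_iff]
  simp [Fin.forall_fin_succ, ofQuadrangle_of]

set_option maxRecDepth 4000 in
/-- A transitive permutation representation of degree seven. -/
def perm : TriangleGroup237 →* Equiv.Perm (Fin 7) :=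
  homOfGens (Equiv.swap 0 1 * Equiv.swap 2 4)
    (Equiv.swap 1 2 * Equiv.swap 2 3 * (Equiv.swap 4 5 * Equiv.swap 5 6))
    (by decide) (by decide) (by decide)

/-- Representatives of the left cosets of the quadrangle group. -/
def cosetRep : Fin 7 → TriangleGroup237 :=
  ![1, x, y * x, y⁻¹ * x, x * y * x, y * x * y * x, y⁻¹ * x * y * x]

set_option maxRecDepth 4000 in
theorem perm_apply_zero_of_mem {t : TriangleGroup237} (ht : t ∈ ofQuadrangle.range) :
    perm t 0 = 0 := by
  have : ofQuadrangle.range ≤ (MulAction.stabilizer (Equiv.Perm (Fin 7)) (0 : Fin 7)).comap perm := by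
    rw [ofQuadrangle_range_le_iff]
    simp only [mem_comap, MulAction.mem_stabilizer_iff, map_mul, map_inv, perm, homOfGens_x,
      homOfGens_y, Equiv.Perm.smul_def]
    decide
  exact this ht

set_option maxRecDepth 4000 in
theorem perm_cosetRep (i : Fin 7) : perm (cosetRep i) 0 = i := by
  fin_cases i <;> simp [cosetRep, perm] <;> decide

/-- The seven listed cosets are permuted by `x` and `y`, as prescribed by `perm`, so they exhaust
the orbit of the trivial coset. -/
theorem mk_eq_mk_cosetRep (t : TriangleGroup237) :
    ∃ i, (t : TriangleGroup237 ⧸ ofQuadrangle.range) = cosetRep i := by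
  have hgen := ofQuadrangle_range_le_iff.1 (le_refl ofQuadrangle.range)
  obtain ⟨h3, h6, h5, h0⟩ := hgen
  let S : Set (TriangleGroup237 ⧸ ofQuadrangle.range) := Set.range fun i => (cosetRep i : _)
  have hstep {s : TriangleGroup237} {σ : Fin 7 → Fin 7}
      (h : ∀ i, (s * cosetRep i)⁻¹ * cosetRep (σ i) ∈ ofQuadrangle.range) :
      s ∈ MulAction.stabilizer TriangleGroup237 S := by
    rw [MulAction.mem_stabilizer_set_iff_smul_set_subset (Set.finite_range _)]
    rintro _ ⟨_, ⟨i, rfl⟩, rfl⟩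
    exact ⟨σ i, (QuotientGroup.eq.2 (h i)).symm⟩
  have hxx : x * x = 1 := by rw [← sq, x_sq]
  have hxg (g : TriangleGroup237) : x * (x * g) = g := by rw [← mul_assoc, hxx, one_mul]
  have hyg (g : TriangleGroup237) : y⁻¹ * (y⁻¹ * g) = y * g := by rw [← mul_assoc, y_inv_sq]
  have hx : x ∈ MulAction.stabilizer TriangleGroup237 S := by
    refine hstep (σ := ![1, 0, 4, 3, 2, 5, 6]) fun i => ?_
    fin_cases i
    · simp [cosetRep]
    · simp [cosetRep, hxx]
    · simp [cosetRep, mul_assoc]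
    · simpa [cosetRep, x_inv, mul_assoc] using h3
    · simp [cosetRep, x_inv, mul_assoc, hxx, hxg]
    · simpa [cosetRep, x_inv, mul_assoc] using h5
    · simpa [cosetRep, x_inv, mul_assoc] using h6
  have hy : y ∈ MulAction.stabilizer TriangleGroup237 S := by
    refine hstep (σ := ![0, 2, 3, 1, 5, 6, 4]) fun i => ?_
    fin_cases i
    · simpa [cosetRep] using h0
    · simp [cosetRep]
    · simp [cosetRep, mul_assoc, hyg]
    · simp [cosetRep]
    · simp [cosetRep, mul_assoc]
    · simp [cosetRep, mul_assoc, hyg]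
    · simp [cosetRep, mul_assoc]
  have ht : t ∈ MulAction.stabilizer TriangleGroup237 S := eq_top_of_mem hx hy ▸ mem_top t
  have h1 : ((1 : TriangleGroup237) : TriangleGroup237 ⧸ ofQuadrangle.range) ∈ S := ⟨0, rfl⟩
  have : t • ((1 : TriangleGroup237) : TriangleGroup237 ⧸ ofQuadrangle.range) ∈ S := by
    rw [← MulAction.mem_stabilizer_iff.1 ht]
    exact Set.smul_mem_smul_set h1
  obtain ⟨i, hi⟩ := this
  exact ⟨i, by simpa using hi.symm⟩

theorem index_ofQuadrangle_range : ofQuadrangle.range.index = 7 := by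
  refine le_antisymm ?_ ?_
  · have := Nat.card_le_card_of_surjective
      (fun i => (cosetRep i : TriangleGroup237 ⧸ ofQuadrangle.range)) (fun q => by
        obtain ⟨t, rfl⟩ := QuotientGroup.mk_surjective q
        obtain ⟨i, hi⟩ := mk_eq_mk_cosetRep t
        exact ⟨i, hi.symm⟩)
    simpa [index] using this
  · have : Finite (TriangleGroup237 ⧸ ofQuadrangle.range) :=
      Finite.of_surjective
      (fun i => (cosetRep i : TriangleGroup237 ⧸ ofQuadrangle.range)) (fun q => by
        obtain ⟨t, rfl⟩ := QuotientGroup.mk_surjective q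
        obtain ⟨i, hi⟩ := mk_eq_mk_cosetRep t
        exact ⟨i, hi.symm⟩)
    have := Nat.card_le_card_of_injective
      (fun i => (cosetRep i : TriangleGroup237 ⧸ ofQuadrangle.range)) (fun i j hij => by
        have := perm_apply_zero_of_mem (QuotientGroup.eq.1 hij)
        rw [map_mul, map_inv, Equiv.Perm.mul_apply, Equiv.Perm.inv_eq_iff_eq, perm_cosetRep,
          perm_cosetRep] at this
        exact this.symm)
    simpa [index] using this

/-- The quadrangle subgroup is maximal. -/
theorem eq_top_or_le_of_ofQuadrangle_range_le {W : Subgroup TriangleGroup237}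
    (h : ofQuadrangle.range ≤ W) : W = ⊤ ∨ W ≤ ofQuadrangle.range := by
  have h1 := relIndex_mul_index h
  rw [index_ofQuadrangle_range] at h1
  rcases (Nat.dvd_prime (by norm_num)).1 (Dvd.intro_left _ h1) with h2 | h2
  · exact Or.inl (index_eq_one.1 h2)
  · refine Or.inr (relIndex_eq_one.1 ?_)
    rw [h2] at h1
    omega

end TriangleGroup237

/-! ### The projection to `PSL27` and the dichotomy for quotients -/

namespace TriangleGroup237

open Subgroup Matrix
open scoped MatrixGroups

instance fact_prime_seven : Fact (Nat.Prime 7) := ⟨by norm_num⟩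

/-- The projection from `SL₂(7)` to `PSL₂(7)`. -/
def proj : SL(2, ZMod 7) →* PSL27 := QuotientGroup.mk' (center SL(2, ZMod 7))

theorem proj_surjective : Function.Surjective proj := QuotientGroup.mk'_surjective _

theorem mem_center_SL27_iff {C : SL(2, ZMod 7)} :
    C ∈ center SL(2, ZMod 7) ↔ C = 1 ∨ C = -1 := by
  rw [Matrix.SpecialLinearGroup.mem_center_iff]
  constructor
  · rintro ⟨r, hr, h⟩
    have hr' : ∀ r : ZMod 7, r ^ 2 = 1 → r = 1 ∨ r = -1 := by decide
    rcases hr' r hr with rfl | rfl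
    · exact Or.inl (Subtype.ext (by simp [← h]))
    · exact Or.inr (Subtype.ext (by rw [← h, map_neg, map_one]; rfl))
  · rintro (rfl | rfl)
    · exact ⟨1, by simp, by simp⟩
    · exact ⟨-1, by decide, by rw [map_neg, map_one]; rfl⟩

theorem proj_eq_proj_iff {A B : SL(2, ZMod 7)} : proj A = proj B ↔ A = B ∨ A = -B := by
  refine (QuotientGroup.eq (s := center SL(2, ZMod 7))).trans (mem_center_SL27_iff.trans ?_)
  rw [inv_mul_eq_iff_eq_mul, inv_mul_eq_iff_eq_mul, mul_one, mul_neg_one]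
  exact or_congr eq_comm (eq_comm.trans neg_eq_iff_eq_neg)

/-- The image of the generator of order two. -/
def matX : SL(2, ZMod 7) := ⟨!![0, 1; -1, 0], by decide⟩

/-- The image of the generator of order three. -/
def matY : SL(2, ZMod 7) := ⟨!![0, -1; 1, 1], by decide⟩

/-- The natural homomorphism to `PSL₂(7)`. -/
def toPSL27 : TriangleGroup237 →* PSL27 :=
  homOfGens (proj matX) (proj matY)
    (by
      rw [← map_pow, ← map_one proj, proj_eq_proj_iff]
      decide)
    (by
      rw [← map_pow, ← map_one proj, proj_eq_proj_iff]
      decide)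
    (by
      rw [← map_mul, ← map_pow, ← map_one proj,
        proj_eq_proj_iff]
      decide)

theorem toPSL27_x : toPSL27 x = (proj matX) := homOfGens_x ..

theorem toPSL27_y : toPSL27 y = (proj matY) := homOfGens_y ..

/-- `matX * matY` is the upper unipotent matrix with entry 1; conjugating by `matX` makes it lower
unipotent with entry -1. -/
theorem transvection_zero_one_eq : ∀ c : ZMod 7,
    SpecialLinearGroup.transvection (zero_ne_one (α := Fin 2)) c = (matX * matY) ^ c.val := by
  decide

theorem transvection_one_zero_eq : ∀ c : ZMod 7,
    SpecialLinearGroup.transvection (one_ne_zero (α := Fin 2)) c =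
      matX * (matX * matY) ^ (-c).val * matX⁻¹ := by
  decide

theorem closure_matX_matY : Subgroup.closure {matX, matY} = ⊤ := by
  rw [eq_top_iff]
  intro A _
  have hX : matX ∈ Subgroup.closure {matX, matY} := subset_closure (by simp)
  have hY : matY ∈ Subgroup.closure {matX, matY} := subset_closure (by simp)
  induction A using SL2.transvection_induction with
  | hmul A B hA hB => exact mul_mem (hA trivial) (hB trivial)
  | htransvec i j h c =>
    fin_cases i <;> fin_cases j
    · exact absurd rfl h
    · exact transvection_zero_one_eq c ▸ pow_mem (mul_mem hX hY) _
    · exact transvection_one_zero_eq c ▸ mul_mem (mul_mem hX (pow_mem (mul_mem hX hY) _)) (inv_mem hX)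
    · exact absurd rfl h

theorem toPSL27_surjective : Function.Surjective toPSL27 := by
  intro g
  obtain ⟨A, rfl⟩ := proj_surjective g
  have : Subgroup.closure {matX, matY} ≤ toPSL27.range.comap proj := by
    rw [closure_le]
    rintro _ (rfl | rfl)
    · exact ⟨x, toPSL27_x⟩
    · exact ⟨y, toPSL27_y⟩
  rw [closure_matX_matY] at this
  exact this (mem_top A)

/-- Lifts of the involutions of a Klein four-subgroup of `PSL₂(7)`. -/
def kleinMat : Fin 3 → SL(2, ZMod 7) :=
  ![⟨!![2, 6; 5, 5], by decide⟩, ⟨!![3, 3; 6, 4], by decide⟩, ⟨!![0, 2; 3, 0], by decide⟩]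

/-- The involutions of a Klein four-subgroup of `PSL₂(7)`. -/
def kleinInvolutions : Set PSL27 := Set.range fun i => proj (kleinMat i)

theorem conj_proj_mem_kleinInvolutions_iff (A v : SL(2, ZMod 7)) :
    proj A * proj v * (proj A)⁻¹ ∈ kleinInvolutions ↔
      ∃ i, kleinMat i = A * v * A⁻¹ ∨ kleinMat i = -(A * v * A⁻¹) := by
  rw [← map_inv, ← map_mul, ← map_mul]
  exact exists_congr fun i => proj_eq_proj_iff

theorem proj_mem_normalizer {A : SL(2, ZMod 7)} (h : ∀ j, ∃ i,
    kleinMat i = A * kleinMat j * A⁻¹ ∨ kleinMat i = -(A * kleinMat j * A⁻¹)) :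
    proj A ∈ normalizer kleinInvolutions := by
  have : Finite kleinInvolutions := Set.finite_range _
  refine mem_normalizer_fintype ?_
  rintro _ ⟨j, rfl⟩
  exact (conj_proj_mem_kleinInvolutions_iff A _).2 (h j)

/-- This bounds the image of `Q` by a proper subgroup; lifting to matrices up to sign makes the
check decidable. -/
theorem map_ofQuadrangle_range_le_normalizer :
    ofQuadrangle.range.map toPSL27 ≤ normalizer kleinInvolutions := by
  rw [map_le_iff_le_comap, ofQuadrangle_range_le_iff]
  have h3 : toPSL27 ((y⁻¹ * x)⁻¹ * x * (y⁻¹ * x)) =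
      proj ((matY⁻¹ * matX)⁻¹ * matX * (matY⁻¹ * matX)) := by
    simp only [map_mul, map_inv, toPSL27_x, toPSL27_y]
  have h6 : toPSL27 ((y⁻¹ * x * y * x)⁻¹ * x * (y⁻¹ * x * y * x)) =
      proj ((matY⁻¹ * matX * matY * matX)⁻¹ * matX * (matY⁻¹ * matX * matY * matX)) := by
    simp only [map_mul, map_inv, toPSL27_x, toPSL27_y]
  have h5 : toPSL27 ((y * x * y * x)⁻¹ * x * (y * x * y * x)) =
      proj ((matY * matX * matY * matX)⁻¹ * matX * (matY * matX * matY * matX)) := by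
    simp only [map_mul, map_inv, toPSL27_x, toPSL27_y]
  rw [mem_comap, mem_comap, mem_comap, mem_comap, h3, h6, h5, toPSL27_y]
  refine ⟨proj_mem_normalizer ?_, proj_mem_normalizer ?_, proj_mem_normalizer ?_,
    proj_mem_normalizer ?_⟩ <;> decide

theorem map_ofQuadrangle_range_ne_top : ofQuadrangle.range.map toPSL27 ≠ ⊤ := by
  intro h
  have h1 : proj (matX * matY) ∈ normalizer kleinInvolutions :=
    map_ofQuadrangle_range_le_normalizer (h ▸ mem_top _)
  have h2 := (conj_proj_mem_kleinInvolutions_iff _ _).1 ((h1 (proj (kleinMat 2))).1 ⟨2, rfl⟩)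
  revert h2
  decide

theorem isSimpleGroup_PSL27 : IsSimpleGroup PSL27 :=
  ProjectiveSpecialLinearGroup.rank_two_simple (by simp)

/-- Used to see that every permutation action of `T` on a finite set is even. -/
theorem eq_one_of_hom_to_units_int (f : TriangleGroup237 →* ℤˣ) : f = 1 := by
  have h7 : (f x * f y) ^ 7 = 1 := by rw [← map_mul, ← map_pow, x_mul_y_pow, map_one]
  have h3 : f y ^ 3 = 1 := by rw [← map_pow, y_cube, map_one]
  have hy : f y = 1 := by
    rcases Int.units_eq_one_or (f y) with h | h
    · exact h
    · rw [h] at h3; exact absurd h3 (by decide)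
  have hx : f x = 1 := by
    rcases Int.units_eq_one_or (f x) with h | h
    · exact h
    · rw [h, hy] at h7; exact absurd h7 (by decide)
  have : f.ker = ⊤ := eq_top_of_mem hx hy
  exact (MonoidHom.ker_eq_top_iff).1 this

theorem isHurwitzGroup_PSL27 : IsHurwitzGroup PSL27 := by
  have := isSimpleGroup_PSL27
  exact ⟨inferInstance, inferInstance, toPSL27, toPSL27_surjective⟩

theorem not_surjective_quadrangle_PSL27 (f : QuadrangleGroup2223 →* PSL27) :
    ¬ Function.Surjective f := by
  intro hf
  set S := ofQuadrangle.range.map toPSL27 with hS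
  have hindex : S.index = 7 := by
    have h := index_map_dvd (H := ofQuadrangle.range) toPSL27_surjective
    rw [index_ofQuadrangle_range] at h
    refine ((Nat.dvd_prime (by norm_num)).1 h).resolve_left fun h1 => ?_
    exact map_ofQuadrangle_range_ne_top (index_eq_one.1 h1)
  classical
  have : Fintype (PSL27 ⧸ S) := Fintype.ofFinite _
  have hcard : Fintype.card (PSL27 ⧸ S) = 7 := by
    rw [← Nat.card_eq_fintype_card]; exact hindex
  let ρ : PSL27 →* Equiv.Perm (PSL27 ⧸ S) := MulAction.toPermHom _ _
  have hsign (g : PSL27) : Equiv.Perm.sign (ρ g) = 1 := by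
    obtain ⟨t, rfl⟩ := toPSL27_surjective g
    exact DFunLike.congr_fun
      (eq_one_of_hom_to_units_int ((Equiv.Perm.sign.comp ρ).comp toPSL27)) t
  let F := ρ.comp f
  have hF (k : Fin 4) : F (PresentedGroup.of k) ^ (![2, 2, 2, 3] k : ℕ) = 1 := by
    rw [← map_pow, QuadrangleGroup2223.of_pow_eq_one, map_one]
  refine Equiv.Perm.not_transitive_of_card_eq_seven hcard (hF 0) (hF 1) (hF 2) (hF 3)
    (hsign _) (hsign _) (hsign _)
    (by simpa using congrArg F QuadrangleGroup2223.of_mul_of_mul_of_mul_of) fun p q => ?_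
  obtain ⟨g, rfl⟩ := MulAction.exists_smul_eq PSL27 p q
  obtain ⟨t, rfl⟩ := hf g
  refine ⟨F t, ?_, rfl⟩
  have : F.range ≤ Subgroup.closure {F (PresentedGroup.of 0), F (PresentedGroup.of 1),
      F (PresentedGroup.of 2), F (PresentedGroup.of 3)} := by
    rw [MonoidHom.range_eq_map, ← PresentedGroup.closure_range_of, MonoidHom.map_closure]
    refine closure_mono ?_
    rw [← Set.range_comp, Set.range_subset_iff]
    simp [Fin.forall_fin_succ]
  exact this ⟨t, rfl⟩

/-- If the quadrangle subgroup does not surject onto a quotient of the triangle group, then that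
quotient surjects onto `PSL₂(7)`. -/
theorem surjective_comp_ofQuadrangle_or_exists {H : Type*} [Group H] {f : TriangleGroup237 →* H}
    (hf : Function.Surjective f) : Function.Surjective (f.comp ofQuadrangle) ∨
      ∃ g : H →* PSL27, Function.Surjective g := by
  -- Maximality is applied to `Q ⊔ ker f`.
  rcases eq_top_or_le_of_ofQuadrangle_range_le (le_sup_left (b := f.ker)) with h | h
  · left
    rw [← MonoidHom.range_eq_top, MonoidHom.range_comp]
    have h1 := congrArg (Subgroup.map f) h
    rwa [Subgroup.map_sup, (Subgroup.map_eq_bot_iff _).2 le_rfl, sup_bot_eq, ← MonoidHom.range_eq_map,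
      MonoidHom.range_eq_top.2 hf] at h1
  · right
    have hker : f.ker ≤ ofQuadrangle.range := le_sup_right.trans h
    have hn : (f.ker.map toPSL27).Normal := Normal.map inferInstance _ toPSL27_surjective
    have hbot : f.ker.map toPSL27 = ⊥ := by
      refine (isSimpleGroup_PSL27.eq_bot_or_eq_top_of_normal _ hn).resolve_right fun htop => ?_
      exact map_ofQuadrangle_range_ne_top (eq_top_iff.2 (htop ▸ map_mono hker))
    have hle : f.ker ≤ toPSL27.ker := (Subgroup.map_eq_bot_iff _).1 hbot
    refine ⟨f.liftOfSurjective hf ⟨toPSL27, hle⟩, fun p => ?_⟩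
    obtain ⟨t, rfl⟩ := toPSL27_surjective p
    exact ⟨f t, MonoidHom.liftOfRightInverse_comp_apply ..⟩

theorem isMaximalReducibleGroup_of_surjective {H : Type*} [Group H] [Finite H] [Nontrivial H]
    {f : TriangleGroup237 →* H} (hf : Function.Surjective f)
    (h : Function.Surjective (f.comp ofQuadrangle)) : IsMaximalReducibleGroup H := by
  refine ⟨inferInstance, f.comp ofQuadrangle, h, fun k hk hfin =>
    QuadrangleGroup2223.eq_one_of_mem_ker_of_isOfFinOrder _ (fun i => ?_) hk hfin⟩
  obtain ⟨hx, hy⟩ := map_x_ne_one_and_map_y_ne_one hf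
  have hc (g : TriangleGroup237) : f (g⁻¹ * x * g) ≠ 1 := by
    intro h1
    rw [map_mul, map_mul, map_inv, mul_eq_one_iff_eq_inv, inv_mul_eq_iff_eq_mul,
      mul_inv_cancel] at h1
    exact hx h1
  rw [MonoidHom.comp_apply, ofQuadrangle_of]
  fin_cases i
  exacts [hc _, hc _, hc _, hy]

end TriangleGroup237

theorem theorem2 :
    (∀ (H : Type*) [Group H], IsHurwitzGroup H →
      (¬ ∃ f : H →* PSL27, Function.Surjective f) → IsMaximalReducibleGroup H) ∧
    (IsSimpleGroup PSL27 ∧ IsHurwitzGroup PSL27 ∧ ¬ IsMaximalReducibleGroup PSL27) ∧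
    (∀ (H : Type*) [Group H], IsSimpleGroup H → IsHurwitzGroup H →
      ¬ IsMaximalReducibleGroup H → Nonempty (H ≃* PSL27)) := by
  refine ⟨?_, ⟨TriangleGroup237.isSimpleGroup_PSL27, TriangleGroup237.isHurwitzGroup_PSL27, ?_⟩, ?_⟩
  · rintro H _ ⟨_, _, f, hf⟩ hno
    exact TriangleGroup237.isMaximalReducibleGroup_of_surjective hf
      ((TriangleGroup237.surjective_comp_ofQuadrangle_or_exists hf).resolve_right hno)
  -- Torsion-freeness plays no role: no surjection exists at all.
  · rintro ⟨_, f, hf, -⟩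
    exact TriangleGroup237.not_surjective_quadrangle_PSL27 f hf
  · rintro H _ hs ⟨_, _, f, hf⟩ hno
    obtain ⟨g, hg⟩ := (TriangleGroup237.surjective_comp_ofQuadrangle_or_exists hf).resolve_left
      fun h => hno (TriangleGroup237.isMaximalReducibleGroup_of_surjective hf h)
    have := TriangleGroup237.isSimpleGroup_PSL27
    have hinj : Function.Injective g := by
      rw [← MonoidHom.ker_eq_bot_iff]
      refine (hs.eq_bot_or_eq_top_of_normal _ inferInstance).resolve_right fun htop => ?_
      obtain ⟨p, hp⟩ := exists_ne (1 : PSL27)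
      obtain ⟨t, rfl⟩ := hg p
      exact hp (MonoidHom.mem_ker.1 (htop ▸ Subgroup.mem_top t))
    exact ⟨MulEquiv.ofBijective g ⟨hinj, hg⟩⟩
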